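/- Consider the Linear Tape Scheduling Problem with U-turn penalty $U\ge 0$. A tape of length $m$ is divided, from left to right, into consecutive files $f$ of positive integer sizes $s(f)$, with left end $\ell(f)$ and right end $r(f)=\ell(f)+s(f)$; $x(f)\in\mathbb{N}$ requests are made on file $f$, with at least one request in total. The reading head starts at the right end of the tape, heading left, moves at unit speed, and pays $U$ time units for each U-turn; a request on $f$ is served when the head has traversed $f$ from left to right. A schedule is a trajectory of the head (with finitely many U-turns) that serves all requests; its cost is the sum of the service times of all requests, and $\mathrm{OPT}$ is the infimum of the costs of all schedules. Let $f_1$ and $f_{\max}$ be the leftmost and rightmost requested files; for a requested file $b$ let $n_\ell(b)$ be the number of requests on files strictly left of $b$, and $\mathrm{left}(b)$ the closest requested file left of $b$. The algorithm SimpleDP is the dynamic program restricted to schedules whose detours (before the leftmost requested file is reached) are pairwise disjoint. With $a=f_1$, its cells are $T[a,a,k]=2s(a)(k+n_\ell(a))$ and, for $a<b$, $T[a,b,k]$ is the minimum of $$T[a,\mathrm{left}(b),k+x(b)]+2(r(b)-r(\mathrm{left}(b)))(k+n_\ell(a))+2(\ell(b)-r(\mathrm{left}(b)))x(b)$$ (file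 $b$ is skipped) and, over the requested files $c$ with $a<c\le b$, of $$T[a,\mathrm{left}(c),k]+2(r(b)-r(\mathrm{left}(c)))(k+n_\ell(a))+2(U+r(b)-\ell(c))(k+n_\ell(c))+\sum_{c<f\le b}2(\ell(f)-\ell(c))x(f)$$ (a detour $(c,b)$: the head makes a U-turn at $\ell(c)$, goes right to $r(b)$, and turns back). SimpleDP returns the schedule that performs the detours $(c,b)$ chosen along the minimizing recursive calls from $T[f_1,f_{\max},0]$, followed by the final sweep from $\ell(f_1)$ to $r(f_{\max})$. Then, for every $U\ge 0$, the approximation ratio of SimpleDP, i.e. the supremum over all instances of the cost of the schedule returned by SimpleDP divided by $\mathrm{OPT}$, lies in $[5/3,3]$. -/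

import Mathlib

open scoped ENNReal

namespace LTSP

/-- An instance of the Linear Tape Scheduling Problem: a tape divided, from left to right, into
`nf` consecutive files of positive integer sizes; `x f` is the number of requests on the file `f`,
and there is at least one request. -/
structure Instance where
  nf : ℕ
  size : Fin nf → ℕ
  size_pos : ∀ f, 0 < size f
  x : Fin nf → ℕ
  exists_request : ∃ f, 0 < x f

namespace Instance

noncomputable section

/-- The length of the tape. -/
def m (I : Instance) : ℝ := ∑ f, (I.size f : ℝ)

/-- The left end of a file, as a distance from the left end of the tape. -/
def l (I : Instance) (f : Fin I.nf) : ℝ := ∑ g ∈ Finset.univ.filter (· < f), (I.size g : ℝ)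

/-- The right end of a file. -/
def r (I : Instance) (f : Fin I.nf) : ℝ := I.l f + I.size f

/-! ### Schedules and their cost -/

/-- A trajectory of the head is given by its successive sweeps: for a sweep `(p, q)`, the head goes
left from its current position to `p`, makes a U-turn, and goes right to `q` (where it makes
another U-turn if a further sweep follows). The predicate says that this is a possible movement
on the tape for a head which is at position `pos`. -/
def IsTrajectory (I : Instance) : ℝ → List (ℝ × ℝ) → Prop
  | _, [] => True
  | pos, (p, q) :: S => 0 ≤ p ∧ p ≤ pos ∧ p ≤ q ∧ q ≤ I.m ∧ IsTrajectory I q S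

/-- A schedule: a trajectory that starts at the right end of the tape and traverses every requested
file from its left end to its right end during some sweep. -/
def IsSchedule (I : Instance) (S : List (ℝ × ℝ)) : Prop :=
  I.IsTrajectory I.m S ∧ ∀ f, 0 < I.x f → ∃ s ∈ S, s.1 ≤ I.l f ∧ I.r f ≤ s.2

/-- The time that a head at position `pos`, with U-turn penalty `U`, needs until it has traversed
the file `f` from left to right for the first time (`0` by convention if it never does). -/
def serviceTime (I : Instance) (U : ℝ) (f : Fin I.nf) : ℝ → List (ℝ × ℝ) → ℝ
  | _, [] => 0
  | pos, (p, q) :: S =>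
    open Classical in
    (pos - p) + U +
      if p ≤ I.l f ∧ I.r f ≤ q then I.r f - p
      else (q - p) + U + serviceTime I U f q S

/-- The cost of a schedule, the sum of the service times of all requests; a list of sweeps which is
not a schedule has infinite cost. -/
def cost (I : Instance) (U : ℝ) (S : List (ℝ × ℝ)) : ℝ≥0∞ :=
  open Classical in
  if I.IsSchedule S then ENNReal.ofReal (∑ f, (I.x f : ℝ) * I.serviceTime U f I.m S) else ⊤

/-- The optimal cost over all schedules. -/
def opt (I : Instance) (U : ℝ) : ℝ≥0∞ := ⨅ S : List (ℝ × ℝ), I.cost U S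

/-! ### The algorithm SimpleDP -/

/-- The requested files, ordered from left to right. -/
abbrev Req (I : Instance) : Type := {f : Fin I.nf // 0 < I.x f}

theorem req_nonempty (I : Instance) : (Finset.univ : Finset I.Req).Nonempty :=
  let ⟨f, hf⟩ := I.exists_request
  ⟨⟨f, hf⟩, Finset.mem_univ _⟩

/-- The leftmost requested file. -/
def first (I : Instance) : I.Req := Finset.univ.min' I.req_nonempty

/-- The rightmost requested file. -/
def last (I : Instance) : I.Req := Finset.univ.max' I.req_nonempty

/-- The number of requests on files located strictly to the left of `b`. -/
def nleft (I : Instance) (b : I.Req) : ℕ := ∑ f ∈ Finset.univ.filter (· < b), I.x f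

/-- The closest requested file to the left of `b` (only used when there is one). -/
def left (I : Instance) (b : I.Req) : I.Req :=
  if h : (Finset.univ.filter (· < b)).Nonempty then (Finset.univ.filter (· < b)).max' h else b

theorem left_lt (I : Instance) {a b : I.Req} (h : a < b) : I.left b < b := by
  have hne : (Finset.univ.filter (· < b)).Nonempty := ⟨a, by simp [h]⟩
  have hmem := Finset.max'_mem _ hne
  rw [left, dif_pos hne]
  simpa using hmem

/-- The better of two candidates, each given by its value and its list of detours. -/
def better {α : Type} (s t : ℝ × α) : ℝ × α :=
  open Classical in if t.1 < s.1 then t else s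

/-- The cell `T[a, b, nskip]` of the dynamic program SimpleDP, together with the list of detours
(in the order in which they are performed) that realises its value. -/
def simpleCell (I : Instance) (U : ℝ) (a b : I.Req) (nskip : ℕ) :
    ℝ × List (I.Req × I.Req) :=
  if h : a < b then
    -- `b` is skipped
    let skip : ℝ × List (I.Req × I.Req) :=
      let T := I.simpleCell U a (I.left b) (nskip + I.x b)
      (T.1 + 2 * (I.r b - I.r (I.left b)) * (nskip + I.nleft a)
          + 2 * (I.l b - I.r (I.left b)) * I.x b,
        T.2)
    -- `b` is read in the detour `(c, b)`, where `a < c ≤ b`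
    let detour (c : {c // c ∈ (Finset.Ioc a b).sort (· ≤ ·)}) : ℝ × List (I.Req × I.Req) :=
      let T := I.simpleCell U a (I.left c.1) nskip
      (T.1 + 2 * (I.r b - I.r (I.left c.1)) * (nskip + I.nleft a)
          + 2 * (U + I.r b - I.l c.1) * (nskip + I.nleft c.1)
          + ∑ f ∈ Finset.Ioc c.1 b, 2 * (I.l f - I.l c.1) * I.x f,
        (c.1, b) :: T.2)
    ((Finset.Ioc a b).sort (· ≤ ·)).attach.foldl (fun best c => better best (detour c)) skip
  else (2 * I.size b * (nskip + I.nleft b), [])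
termination_by b.1.val
decreasing_by
  · exact I.left_lt h
  · have hc := (Finset.mem_sort _).1 c.2
    rw [Finset.mem_Ioc] at hc
    exact lt_of_lt_of_le (I.left_lt hc.1) hc.2

/-- The schedule returned by SimpleDP: the detours of the cell `T[first, last, 0]`, followed by the
final detour from the leftmost to the rightmost requested file. A detour `(c, b)` is the sweep from
the left end of `c` to the right end of `b`. -/
def simpleDP (U : ℝ) (I : Instance) : List (ℝ × ℝ) :=
  ((I.simpleCell U I.first I.last 0).2 ++ [(I.first, I.last)]).map
    fun d => (I.l d.1, I.r d.2)

end

end Instance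

/-- The approximation ratio, for the U-turn penalty `U`, of an algorithm that maps instances to
schedules: the supremum over all instances of the cost of its schedule over the optimal cost. -/
noncomputable def approxRatio (U : ℝ) (A : Instance → List (ℝ × ℝ)) : ℝ≥0∞ :=
  ⨆ I : Instance, I.cost U (A I) / I.opt U

end LTSP

namespace LTSP

namespace Instance

open Finset

/-! ### Positions of files -/

/-! Every service time of a schedule with disjoint detours is a fixed direct term (run left to the
file, turn, read it) plus a delay. The DP value is exactly the total delay of the returned schedule
(`simpleCell_first_spec`, `cost_simpleDP`), so both bounds reduce to estimates of one cell.

Upper bound: given any schedule `S`, group the requested files by the first sweep of `S` that starts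
at or left of them. Groups are intervals, so reading each in one detour (the leftmost in the final
sweep) is available to SimpleDP. If the sweep of `f` starts at `g` and has index `h`, the delay of
`f` is then at most `2 * (m - g) + 2 * h * U` (`simpleCell_first_le`). In `S` the head must reach
`g` and come back to `r f`, after two U-turns per earlier sweep (`serviceTime_ge`). Hence the direct
term is at most one service time of `S`, and the delay at most two.

Lower bound: in `nestedInstance` a detour nested in a longer one gives cost about `3 * n ^ 2 * A`.
Disjoint detours have direct cost at least `3 * n ^ 2 * A`, and every way of reading the last file
adds a delay of `2 * n ^ 2 * A`. -/

theorem l_nonneg (I : Instance) (f : Fin I.nf) : 0 ≤ I.l f :=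
  sum_nonneg fun _ _ => Nat.cast_nonneg _

theorem r_eq (I : Instance) (f : Fin I.nf) :
    I.r f = ∑ g ∈ univ.filter (· ≤ f), (I.size g : ℝ) := by
  have : univ.filter (· ≤ f) = insert f (univ.filter (· < f)) := by
    ext g; simp [le_iff_eq_or_lt]
  rw [this, sum_insert (by simp), r, l, add_comm]

theorem r_le_m (I : Instance) (f : Fin I.nf) : I.r f ≤ I.m := by
  rw [r_eq]
  exact sum_le_sum_of_subset_of_nonneg (filter_subset _ _) fun _ _ _ => Nat.cast_nonneg _

theorem r_le_l_of_lt (I : Instance) {f g : Fin I.nf} (h : f < g) : I.r f ≤ I.l g := by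
  rw [r_eq]
  refine sum_le_sum_of_subset_of_nonneg (fun e he => ?_) fun _ _ _ => Nat.cast_nonneg _
  simp only [mem_filter, mem_univ, true_and] at he ⊢
  exact lt_of_le_of_lt he h

theorem l_lt_r (I : Instance) (f : Fin I.nf) : I.l f < I.r f :=
  lt_add_of_pos_right _ (Nat.cast_pos.2 (I.size_pos f))

theorem l_strictMono (I : Instance) : StrictMono I.l := fun f _ h =>
  (I.l_lt_r f).trans_le (I.r_le_l_of_lt h)

theorem r_strictMono (I : Instance) : StrictMono I.r := fun _ g h =>
  (I.r_le_l_of_lt h).trans_lt (I.l_lt_r g)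

/-! ### The order of the requested files -/

theorem first_le (I : Instance) (f : I.Req) : I.first ≤ f := min'_le _ _ (mem_univ _)

theorem le_last (I : Instance) (f : I.Req) : f ≤ I.last := le_max' _ _ (mem_univ _)

theorem lt_iff_le_left (I : Instance) {a b : I.Req} (h : a < b) (f : I.Req) :
    f < b ↔ f ≤ I.left b := by
  refine ⟨fun hf => ?_, fun hf => hf.trans_lt (I.left_lt h)⟩
  have hne : (univ.filter (· < b)).Nonempty := ⟨a, by simp [h]⟩
  rw [left, dif_pos hne]
  exact le_max' _ _ (by simpa using hf)

theorem Iic_left (I : Instance) {a b : I.Req} (h : a < b) : Iic (I.left b) = Iio b := by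
  ext f; simp [I.lt_iff_le_left h f]

theorem nleft_eq (I : Instance) (b : I.Req) : I.nleft b = ∑ f ∈ Iio b, I.x f := by
  rw [nleft]; congr 1; ext; simp

theorem nleft_first (I : Instance) : I.nleft I.first = 0 := by
  rw [nleft_eq, sum_eq_zero]
  intro f hf
  exact absurd (mem_Iio.1 hf) (not_lt.2 (I.first_le f))

theorem r_left_le (I : Instance) {a b : I.Req} (h : a < b) : I.r (I.left b) ≤ I.l b :=
  I.r_le_l_of_lt (I.left_lt h)

theorem sum_req (I : Instance) (g : Fin I.nf → ℝ) :
    ∑ f, (I.x f : ℝ) * g f = ∑ f : I.Req, (I.x f : ℝ) * g f := by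
  rw [← sum_subtype (univ.filter fun f => 0 < I.x f) (by simp) fun f => (I.x f : ℝ) * g f,
    sum_filter]
  refine sum_congr rfl fun f _ => ?_
  split_ifs with h
  · rfl
  · simp [Nat.eq_zero_of_not_pos h]

/-! ### The cells of the dynamic program -/

section Fold

variable {α γ : Type} (F : γ → ℝ × α)

theorem better_fst_le_left (s t : ℝ × α) : (better s t).1 ≤ s.1 := by
  unfold better; split_ifs with h; exacts [h.le, le_rfl]

theorem better_fst_le_right (s t : ℝ × α) : (better s t).1 ≤ t.1 := by
  unfold better; split_ifs with h; exacts [le_rfl, not_lt.1 h]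

/-- With the two inequalities that follow, this is all that is used of the fold: the minimum is
attained and bounds every candidate. Tie-breaking is irrelevant. -/
theorem foldl_better_cases (L : List γ) (s : ℝ × α) :
    L.foldl (fun t c => better t (F c)) s = s ∨
      ∃ c ∈ L, L.foldl (fun t c => better t (F c)) s = F c := by
  induction L generalizing s with
  | nil => exact Or.inl rfl
  | cons d L ih =>
    rcases ih (better s (F d)) with h | ⟨c, hc, h⟩
    · rw [List.foldl_cons, h]
      unfold better
      split_ifs
      exacts [Or.inr ⟨d, by simp, rfl⟩, Or.inl rfl]
    · exact Or.inr ⟨c, List.mem_cons_of_mem _ hc, h⟩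

theorem foldl_better_le_init (L : List γ) (s : ℝ × α) :
    (L.foldl (fun t c => better t (F c)) s).1 ≤ s.1 := by
  induction L generalizing s with
  | nil => exact le_rfl
  | cons d L ih => exact (ih _).trans (better_fst_le_left _ _)

theorem foldl_better_le_mem (L : List γ) (s : ℝ × α) {c : γ} (hc : c ∈ L) :
    (L.foldl (fun t c => better t (F c)) s).1 ≤ (F c).1 := by
  induction L generalizing s with
  | nil => simp at hc
  | cons d L ih =>
    rcases List.mem_cons.1 hc with rfl | hc
    · exact (foldl_better_le_init F L _).trans (better_fst_le_right _ _)
    · exact ih _ hc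

end Fold

/-- The candidate for a cell in which the file `b` is skipped. -/
noncomputable def skipCell (I : Instance) (U : ℝ) (a b : I.Req) (k : ℕ) :
    ℝ × List (I.Req × I.Req) :=
  let T := I.simpleCell U a (I.left b) (k + I.x b)
  (T.1 + 2 * (I.r b - I.r (I.left b)) * (k + I.nleft a) + 2 * (I.l b - I.r (I.left b)) * I.x b,
    T.2)

/-- The candidate for a cell that performs the detour `(c, b)`. -/
noncomputable def detourCell (I : Instance) (U : ℝ) (a b c : I.Req) (k : ℕ) :
    ℝ × List (I.Req × I.Req) :=
  let T := I.simpleCell U a (I.left c) k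
  (T.1 + 2 * (I.r b - I.r (I.left c)) * (k + I.nleft a)
      + 2 * (U + I.r b - I.l c) * (k + I.nleft c)
      + ∑ f ∈ Ioc c b, 2 * (I.l f - I.l c) * I.x f,
    (c, b) :: T.2)

theorem simpleCell_of_lt (I : Instance) (U : ℝ) {a b : I.Req} (h : a < b) (k : ℕ) :
    I.simpleCell U a b k = ((Ioc a b).sort (· ≤ ·)).attach.foldl
      (fun t c => better t (I.detourCell U a b c.1 k)) (I.skipCell U a b k) := by
  rw [simpleCell, dif_pos h]
  rfl

theorem simpleCell_self (I : Instance) (U : ℝ) (a : I.Req) (k : ℕ) :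
    I.simpleCell U a a k = (2 * (I.size a : ℝ) * (k + I.nleft a), []) := by
  rw [simpleCell, dif_neg (lt_irrefl a)]

theorem simpleCell_cases (I : Instance) (U : ℝ) {a b : I.Req} (h : a < b) (k : ℕ) :
    I.simpleCell U a b k = I.skipCell U a b k ∨
      ∃ c ∈ Ioc a b, I.simpleCell U a b k = I.detourCell U a b c k := by
  rw [simpleCell_of_lt I U h]
  rcases foldl_better_cases
    (fun c : {c // c ∈ (Ioc a b).sort (· ≤ ·)} => I.detourCell U a b c.1 k)
    ((Ioc a b).sort (· ≤ ·)).attach (I.skipCell U a b k) with h | ⟨c, -, h⟩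
  · exact Or.inl h
  · exact Or.inr ⟨c.1, (mem_sort _).1 c.2, h⟩

theorem simpleCell_le_skipCell (I : Instance) (U : ℝ) {a b : I.Req} (h : a < b) (k : ℕ) :
    (I.simpleCell U a b k).1 ≤ (I.skipCell U a b k).1 := by
  rw [simpleCell_of_lt I U h]
  exact foldl_better_le_init
    (fun c : {c // c ∈ (Ioc a b).sort (· ≤ ·)} => I.detourCell U a b c.1 k) _ _

theorem simpleCell_le_detourCell (I : Instance) (U : ℝ) {a b c : I.Req} (hc : c ∈ Ioc a b)
    (k : ℕ) : (I.simpleCell U a b k).1 ≤ (I.detourCell U a b c k).1 := by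
  have h : a < b := (mem_Ioc.1 hc).1.trans_le (mem_Ioc.1 hc).2
  rw [simpleCell_of_lt I U h]
  exact foldl_better_le_mem
    (fun c : {c // c ∈ (Ioc a b).sort (· ≤ ·)} => I.detourCell U a b c.1 k) _ _
    (c := ⟨c, (mem_sort _).2 hc⟩) (List.mem_attach _ _)

/-! ### The cost of schedules with disjoint detours -/

/-- The schedule that performs the detours `D` and then the final sweep. -/
noncomputable def sweeps (I : Instance) (D : List (I.Req × I.Req)) : List (ℝ × ℝ) :=
  (D ++ [(I.first, I.last)]).map fun d => (I.l d.1, I.r d.2)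

/-- The total time spent on the detours `D`. -/
noncomputable def detourTime (I : Instance) (U : ℝ) : List (I.Req × I.Req) → ℝ
  | [] => 0
  | d :: D => 2 * (U + I.r d.2 - I.l d.1) + detourTime I U D

/-- The delay of the service of `f` in the schedule `sweeps D`, compared to a head that goes
directly to the left end of `f` and reads `f`. -/
noncomputable def delay (I : Instance) (U : ℝ) (f : I.Req) : List (I.Req × I.Req) → ℝ
  | [] => 2 * (I.l f - I.l I.first)
  | d :: D =>
    open Classical in
    if d.1 ≤ f ∧ f ≤ d.2 then 2 * (I.l f - I.l d.1)
    else 2 * (U + I.r d.2 - I.l d.1) + delay I U f D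

/-- Positions telescope: compared with going straight to `f`, a detour that does not read `f` is a
round trip with two U-turns. Disjointness plays no role, since the final sweep reads whatever is
left. -/
theorem serviceTime_sweeps (I : Instance) (U : ℝ) (f : I.Req) (D : List (I.Req × I.Req))
    (pos : ℝ) :
    I.serviceTime U f pos (I.sweeps D) = pos - I.l f + I.size f + U + I.delay U f D := by
  induction D generalizing pos with
  | nil =>
    have h1 : I.l I.first ≤ I.l f := I.l_strictMono.monotone (I.first_le f)
    have h2 : I.r f ≤ I.r I.last := I.r_strictMono.monotone (I.le_last f)
    simp only [sweeps, List.nil_append, List.map_cons, List.map_nil, serviceTime, delay,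
      h1, h2, and_self, if_true]
    rw [r]; ring
  | cons d D ih =>
    have h : (I.l d.1 ≤ I.l f ∧ I.r f ≤ I.r d.2) ↔ (d.1 ≤ f ∧ f ≤ d.2) :=
      and_congr I.l_strictMono.le_iff_le I.r_strictMono.le_iff_le
    have ih' := ih (I.r d.2)
    simp only [sweeps] at ih'
    simp only [sweeps, List.cons_append, List.map_cons, serviceTime, delay, h, ih']
    split_ifs
    · rw [r]; ring
    · ring

theorem delay_of_forall_lt (I : Instance) (U : ℝ) (f : I.Req) (D : List (I.Req × I.Req))
    (h : ∀ d ∈ D, d.2 < f) :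
    I.delay U f D = 2 * (I.l f - I.l I.first) + I.detourTime U D := by
  induction D with
  | nil => simp [delay, detourTime]
  | cons d D ih =>
    have hd := h d (by simp)
    rw [delay, if_neg fun h' => not_le.2 hd h'.2, detourTime,
      ih fun e he => h e (List.mem_cons_of_mem _ he)]
    ring

theorem detourTime_nonneg (I : Instance) {U : ℝ} (hU : 0 ≤ U) (D : List (I.Req × I.Req))
    (h : ∀ d ∈ D, d.1 ≤ d.2) : 0 ≤ I.detourTime U D := by
  induction D with
  | nil => exact le_rfl
  | cons d D ih =>
    have h1 : I.l d.1 ≤ I.l d.2 := I.l_strictMono.monotone (h d (by simp))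
    have h2 := I.l_lt_r d.2
    have := ih fun e he => h e (List.mem_cons_of_mem _ he)
    rw [detourTime]; linarith

theorem delay_nonneg (I : Instance) {U : ℝ} (hU : 0 ≤ U) (f : I.Req) (D : List (I.Req × I.Req))
    (h : ∀ d ∈ D, d.1 ≤ d.2) : 0 ≤ I.delay U f D := by
  induction D with
  | nil =>
    have h1 : I.l I.first ≤ I.l f := I.l_strictMono.monotone (I.first_le f)
    rw [delay]; linarith
  | cons d D ih =>
    have h1 : I.l d.1 ≤ I.l d.2 := I.l_strictMono.monotone (h d (by simp))
    have h2 := I.l_lt_r d.2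
    have := ih fun e he => h e (List.mem_cons_of_mem _ he)
    rw [delay]
    split_ifs with hf
    · have : I.l d.1 ≤ I.l f := I.l_strictMono.monotone hf.1
      linarith
    · linarith

/-- Detours are listed from right to left, so each one starts to the left of where the previous one
ended. -/
theorem isTrajectory_sweeps (I : Instance) (D : List (I.Req × I.Req)) (pos : ℝ)
    (h : ∀ d ∈ D, d.1 ≤ d.2) (hp : D.Pairwise fun d e => e.2 < d.1)
    (hpos : ∀ d ∈ D, I.l d.1 ≤ pos) (hpos' : I.l I.first ≤ pos) :
    I.IsTrajectory pos (I.sweeps D) := by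
  induction D generalizing pos with
  | nil =>
    have h1 : I.l I.first ≤ I.l I.last := I.l_strictMono.monotone (I.first_le _)
    exact ⟨I.l_nonneg _, hpos', h1.trans (I.l_lt_r _).le, I.r_le_m _, trivial⟩
  | cons d D ih =>
    have hd : d.1 ≤ d.2 := h d (by simp)
    have h1 : I.l d.1 ≤ I.l d.2 := I.l_strictMono.monotone hd
    have h2 := I.l_lt_r d.2
    refine ⟨I.l_nonneg _, hpos d (by simp), h1.trans h2.le, I.r_le_m _,
      ih _ (fun e he => h e (List.mem_cons_of_mem _ he)) (List.pairwise_cons.1 hp).2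
        (fun e he => ?_) ?_⟩
    · have he1 := (h e (List.mem_cons_of_mem _ he)).trans_lt ((List.pairwise_cons.1 hp).1 e he)
      have : I.l e.1 ≤ I.l d.2 := I.l_strictMono.monotone (he1.le.trans hd)
      exact this.trans h2.le
    · exact (I.l_strictMono.monotone (I.first_le d.2)).trans h2.le

/-- The detours of a cell are disjoint, and its value is the total delay of the requests up to `b`
together with that of the skipped ones. -/
theorem simpleCell_first_spec (I : Instance) (U : ℝ) (b : I.Req) (k : ℕ) :
    (∀ d ∈ (I.simpleCell U I.first b k).2, d.1 ≤ d.2 ∧ d.2 ≤ b) ∧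
    (I.simpleCell U I.first b k).2.Pairwise (fun d e => e.2 < d.1) ∧
    (I.simpleCell U I.first b k).1 =
      ∑ f ∈ Iic b, (I.x f : ℝ) * I.delay U f (I.simpleCell U I.first b k).2
        + k * (2 * (I.r b - I.l I.first) + I.detourTime U (I.simpleCell U I.first b k).2) := by
  induction b using WellFoundedLT.induction generalizing k with
  | ind b ih =>
    rcases (I.first_le b).eq_or_lt with rfl | hb
    · rw [simpleCell_self]
      have h0 : Iic I.first = {I.first} := by
        ext f; simpa using ⟨fun h => le_antisymm h (I.first_le f), fun h => h.le⟩
      simp [h0, delay, detourTime, nleft_first, r]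
      ring
    rcases I.simpleCell_cases U hb k with h | ⟨c, hc, h⟩
    · have hl := I.left_lt hb
      obtain ⟨h1, h2, h3⟩ := ih _ hl (k + I.x b)
      rw [h, skipCell]
      dsimp only
      set D := (I.simpleCell U I.first (I.left b) (k + I.x b)).2 with hD
      refine ⟨fun d hd => ⟨(h1 d hd).1, (h1 d hd).2.trans hl.le⟩, h2, ?_⟩
      rw [h3, Iic_left I hb, ← Iio_insert, sum_insert (by simp),
        I.delay_of_forall_lt U b D fun d hd => (h1 d hd).2.trans_lt hl, nleft_first]
      push_cast
      ring
    · obtain ⟨hac, hcb⟩ := mem_Ioc.1 hc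
      have hl := I.left_lt hac
      obtain ⟨h1, h2, h3⟩ := ih _ (hl.trans_le hcb) k
      rw [h, detourCell]
      dsimp only
      set D := (I.simpleCell U I.first (I.left c) k).2 with hD
      refine ⟨?_, ?_, ?_⟩
      · rintro d hd
        rcases List.mem_cons.1 hd with rfl | hd
        · exact ⟨hcb, le_rfl⟩
        · exact ⟨(h1 d hd).1, (h1 d hd).2.trans (hl.le.trans hcb)⟩
      · exact List.pairwise_cons.2 ⟨fun d hd => (h1 d hd).2.trans_lt hl, h2⟩
      · have hsplit : Iic b = Iio c ∪ insert c (Ioc c b) := by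
          ext f
          simp only [mem_Iic, mem_union, mem_Iio, mem_insert, mem_Ioc]
          constructor
          · intro hf
            rcases lt_trichotomy f c with h | h | h
            exacts [Or.inl h, Or.inr (Or.inl h), Or.inr (Or.inr ⟨h, hf⟩)]
          · rintro (h | rfl | h)
            exacts [h.le.trans hcb, hcb, h.2]
        have hdisj : Disjoint (Iio c) (insert c (Ioc c b)) := by
          rw [Finset.disjoint_left]
          intro f hf hf'
          simp only [mem_insert, mem_Ioc, mem_Iio] at hf hf'
          rcases hf' with rfl | h
          exacts [lt_irrefl _ hf, lt_asymm hf h.1]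
        have e1 : ∑ f ∈ Iio c, (I.x f : ℝ) * I.delay U f ((c, b) :: D) =
            2 * (U + I.r b - I.l c) * I.nleft c + ∑ f ∈ Iio c, (I.x f : ℝ) * I.delay U f D := by
          rw [nleft_eq, Nat.cast_sum, mul_sum, ← sum_add_distrib]
          refine sum_congr rfl fun f hf => ?_
          rw [delay, if_neg fun h => not_le.2 (mem_Iio.1 hf) h.1]
          ring
        have e2 : ∑ f ∈ Ioc c b, (I.x f : ℝ) * I.delay U f ((c, b) :: D) =
            ∑ f ∈ Ioc c b, 2 * (I.l f - I.l c) * I.x f := by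
          refine sum_congr rfl fun f hf => ?_
          rw [mem_Ioc] at hf
          rw [delay, if_pos ⟨hf.1.le, hf.2⟩]
          ring
        rw [hsplit, sum_union hdisj, sum_insert (by simp), e1, e2, h3, Iic_left I hac, delay,
          if_pos ⟨le_rfl, hcb⟩, detourTime, nleft_first]
        push_cast
        ring

/-- The sum over all requests of the time for reading the file directly. -/
noncomputable def directCost (I : Instance) (U : ℝ) : ℝ :=
  ∑ f : I.Req, (I.x f : ℝ) * (I.m - I.l f + I.size f + U)

theorem cost_simpleDP (I : Instance) (U : ℝ) :
    I.cost U (I.simpleDP U) =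
      ENNReal.ofReal (I.directCost U + (I.simpleCell U I.first I.last 0).1) := by
  obtain ⟨h1, h2, h3⟩ := I.simpleCell_first_spec U I.last 0
  have hS : I.simpleDP U = I.sweeps (I.simpleCell U I.first I.last 0).2 := rfl
  have hm : ∀ f, I.l f ≤ I.m := fun f => (I.l_lt_r f).le.trans (I.r_le_m f)
  have hsched : I.IsSchedule (I.simpleDP U) := by
    rw [hS]
    refine ⟨I.isTrajectory_sweeps _ _ (fun d hd => (h1 d hd).1) h2 (fun d _ => hm _) (hm _),
      fun f hf => ⟨(I.l I.first, I.r I.last), ?_, I.l_strictMono.monotone (I.first_le ⟨f, hf⟩),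
        I.r_strictMono.monotone (I.le_last ⟨f, hf⟩)⟩⟩
    simp [sweeps]
  rw [cost, if_pos hsched, hS, sum_req, h3, directCost]
  congr 1
  have : Iic I.last = univ := by ext f; simp [I.le_last f]
  rw [this, Nat.cast_zero, zero_mul, add_zero, ← sum_add_distrib]
  refine sum_congr rfl fun f _ => ?_
  rw [serviceTime_sweeps]
  ring

/-- The `k` skipped requests are served by the final sweep, hence wait for the round trip between
`b` and the first file. -/
theorem simpleCell_first_ge (I : Instance) {U : ℝ} (hU : 0 ≤ U) (b : I.Req) (k : ℕ) :
    2 * (I.r b - I.l I.first) * k ≤ (I.simpleCell U I.first b k).1 := by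
  obtain ⟨h1, -, h3⟩ := I.simpleCell_first_spec U b k
  rw [h3]
  have e1 := I.detourTime_nonneg hU _ fun d hd => (h1 d hd).1
  have e2 : 0 ≤ ∑ f ∈ Iic b, (I.x f : ℝ) * I.delay U f (I.simpleCell U I.first b k).2 :=
    sum_nonneg fun f _ => mul_nonneg (Nat.cast_nonneg _)
      (I.delay_nonneg hU f _ fun d hd => (h1 d hd).1)
  nlinarith [mul_nonneg (Nat.cast_nonneg (α := ℝ) k) e1]

/-! ### The upper bound -/

/-- If all the files up to `b` are skipped from `b` on, the value of the cell is that of the final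
sweep. -/
theorem simpleCell_first_le_skip (I : Instance) (U : ℝ) (b : I.Req) (k : ℕ) :
    (I.simpleCell U I.first b k).1 ≤
      ∑ f ∈ Iic b, (I.x f : ℝ) * (2 * (I.l f - I.l I.first)) + 2 * (I.r b - I.l I.first) * k := by
  induction b using WellFoundedLT.induction generalizing k with
  | ind b ih =>
    rcases (I.first_le b).eq_or_lt with rfl | hb
    · have h0 : Iic I.first = {I.first} := by
        ext f; simpa using ⟨fun h => le_antisymm h (I.first_le f), fun h => h.le⟩
      simp [simpleCell_self, h0, nleft_first, r]
    · refine (I.simpleCell_le_skipCell U hb k).trans ?_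
      have := ih _ (I.left_lt hb) (k + I.x b)
      rw [Iic_left I hb] at this
      rw [skipCell, ← Iio_insert, sum_insert (by simp), nleft_first]
      push_cast at this ⊢
      linarith

/-- A partition of the requested files into groups `h`, each of them read in one detour, bounds the
value of a cell. -/
theorem simpleCell_first_le (I : Instance) {U : ℝ} (hU : 0 ≤ U) (h : I.Req → ℕ) (g : I.Req → ℝ)
    (hanti : Antitone h) (hg : ∀ f c, h f = h c → g f = g c) (hgl : ∀ f, g f ≤ I.l f)
    (b : I.Req) :
    (I.simpleCell U I.first b 0).1 ≤
      ∑ f ∈ Iic b, (I.x f : ℝ) * (2 * (I.r b - g f) + 2 * ((h f : ℝ) - h b) * U) := by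
  induction b using WellFoundedLT.induction with
  | ind b ih =>
    have hne : (univ.filter fun f => h f = h b).Nonempty := ⟨b, by simp⟩
    -- The group of `b`, cut at `b`, is the interval from `c` to `b`; the induction continues at
    -- `left c`, in the next group.
    obtain ⟨c, hc, hcmin⟩ : ∃ c, h c = h b ∧ ∀ f, h f = h b → c ≤ f :=
      ⟨_, (mem_filter.1 (min'_mem _ hne)).2, fun f hf => min'_le _ _ (by simpa using hf)⟩
    have hcb : c ≤ b := hcmin b rfl
    have hgroup : ∀ f, c ≤ f → f ≤ b → h f = h b := fun f h1 h2 =>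
      le_antisymm ((hanti h1).trans hc.le) (hanti h2)
    have hread : ∀ f, c ≤ f → f ≤ b →
        2 * (I.l f - I.l c) ≤ 2 * (I.r b - g f) + 2 * ((h f : ℝ) - h b) * U := by
      intro f h1 h2
      have e1 : g f ≤ I.l c := (hg f c ((hgroup f h1 h2).trans hc.symm)).trans_le (hgl c)
      have e2 : I.l f ≤ I.l b := I.l_strictMono.monotone h2
      have e3 := I.l_lt_r b
      rw [hgroup f h1 h2, sub_self]
      linarith
    rcases (I.first_le c).eq_or_lt with hac | hac
    -- The leftmost group needs no detour: the final sweep reads it.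
    · refine (I.simpleCell_first_le_skip U b 0).trans ?_
      rw [Nat.cast_zero, mul_zero, add_zero]
      refine sum_le_sum fun f hf => mul_le_mul_of_nonneg_left ?_ (Nat.cast_nonneg _)
      rw [hac]
      exact hread f (hac ▸ I.first_le f) (mem_Iic.1 hf)
    · refine (I.simpleCell_le_detourCell U (mem_Ioc.2 ⟨hac, hcb⟩) 0).trans ?_
      have hl := I.left_lt hac
      have ih' := ih _ (hl.trans_le hcb)
      rw [Iic_left I hac] at ih'
      have hsplit : Iic b = Iio c ∪ Icc c b := by
        ext f
        simp only [mem_Iic, mem_union, mem_Iio, mem_Icc]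
        exact ⟨fun hf => (lt_or_ge f c).imp id fun h => ⟨h, hf⟩,
          fun hf => hf.elim (fun h => h.le.trans hcb) fun h => h.2⟩
      have hdisj : Disjoint (Iio c) (Icc c b) := by
        rw [Finset.disjoint_left]
        intro f hf hf'
        exact not_le.2 (mem_Iio.1 hf) (mem_Icc.1 hf').1
      -- The index jumps by at least one between groups, which pays for the `2 * U` of the detour.
      have hstep : (h b : ℝ) + 1 ≤ h (I.left c) := by
        have h1 : h b ≤ h (I.left c) := hc ▸ hanti hl.le
        have h2 : h (I.left c) ≠ h b := fun h' => not_le.2 hl (hcmin _ h')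
        exact_mod_cast lt_of_le_of_ne h1 h2.symm
      have e1 : ∑ f ∈ Iio c, (I.x f : ℝ) *
            (2 * (I.r (I.left c) - g f) + 2 * ((h f : ℝ) - h (I.left c)) * U)
          + 2 * (U + I.r b - I.l c) * I.nleft c ≤
          ∑ f ∈ Iio c, (I.x f : ℝ) * (2 * (I.r b - g f) + 2 * ((h f : ℝ) - h b) * U) := by
        rw [nleft_eq, Nat.cast_sum, mul_sum, ← sum_add_distrib]
        refine sum_le_sum fun f hf => ?_
        rw [mul_comm (2 * (U + I.r b - I.l c)), ← mul_add]
        refine mul_le_mul_of_nonneg_left ?_ (Nat.cast_nonneg _)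
        have := I.r_left_le hac
        nlinarith
      have e2 : ∑ f ∈ Ioc c b, 2 * (I.l f - I.l c) * (I.x f : ℝ) ≤
          ∑ f ∈ Icc c b, (I.x f : ℝ) * (2 * (I.r b - g f) + 2 * ((h f : ℝ) - h b) * U) := by
        rw [← Ioc_insert_left hcb, sum_insert (by simp)]
        refine le_add_of_nonneg_of_le (mul_nonneg (Nat.cast_nonneg _) ?_)
          (sum_le_sum fun f hf => ?_)
        · have := hread c le_rfl hcb
          rwa [sub_self, mul_zero] at this
        · rw [mul_comm]
          exact mul_le_mul_of_nonneg_left (hread f (mem_Ioc.1 hf).1.le (mem_Ioc.1 hf).2)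
            (Nat.cast_nonneg _)
      rw [detourCell, hsplit, sum_union hdisj, nleft_first]
      simp only [Nat.cast_zero, zero_add, add_zero, mul_zero]
      linarith

/-- The number of sweeps before the first one that starts at or to the left of `y`. -/
noncomputable def sweepIndex (y : ℝ) : List (ℝ × ℝ) → ℕ
  | [] => 0
  | s :: S => open Classical in if s.1 ≤ y then 0 else sweepIndex y S + 1

/-- The start of the first sweep that starts at or to the left of `y`. -/
noncomputable def sweepStart (y : ℝ) (S : List (ℝ × ℝ)) : ℝ :=
  (S[sweepIndex y S]?.map Prod.fst).getD 0

theorem sweepIndex_anti (S : List (ℝ × ℝ)) : Antitone fun y => sweepIndex y S := by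
  intro y z hyz
  induction S with
  | nil => exact le_rfl
  | cons s S ih =>
    simp only [sweepIndex] at ih ⊢
    split_ifs with h1 h2
    · exact le_rfl
    · exact Nat.zero_le _
    · exact absurd (‹s.1 ≤ y›.trans hyz) h1
    · exact Nat.succ_le_succ ih

theorem sweepStart_cons_of_le {y : ℝ} {s : ℝ × ℝ} (S : List (ℝ × ℝ)) (h : s.1 ≤ y) :
    sweepStart y (s :: S) = s.1 := by
  simp [sweepStart, sweepIndex, h]

theorem sweepStart_cons_of_lt {y : ℝ} {s : ℝ × ℝ} (S : List (ℝ × ℝ)) (h : ¬ s.1 ≤ y) :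
    sweepStart y (s :: S) = sweepStart y S := by
  simp [sweepStart, sweepIndex, h]

/-- The hypothesis `0 ≤ y` covers the default value `0`, taken when no sweep starts at or left of
`y`. -/
theorem sweepStart_le {y : ℝ} (hy : 0 ≤ y) (S : List (ℝ × ℝ)) : sweepStart y S ≤ y := by
  induction S with
  | nil => simpa [sweepStart] using hy
  | cons s S ih =>
    by_cases h : s.1 ≤ y
    · rwa [sweepStart_cons_of_le S h]
    · rwa [sweepStart_cons_of_lt S h]

/-- Needed when the first sweep starting left of `f` stops before reading it: the head must still
get to `r f` at unit speed. -/
theorem serviceTime_ge_direct (I : Instance) {U : ℝ} (hU : 0 ≤ U) (f : Fin I.nf) (pos : ℝ)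
    (S : List (ℝ × ℝ)) (hS : I.IsTrajectory pos S)
    (hf : ∃ s ∈ S, s.1 ≤ I.l f ∧ I.r f ≤ s.2) :
    I.r f - pos + U ≤ I.serviceTime U f pos S := by
  induction S generalizing pos with
  | nil => simp at hf
  | cons s S ih =>
    obtain ⟨p, q⟩ := s
    obtain ⟨-, h2, h3, -, h5⟩ := hS
    rw [serviceTime]
    split_ifs with h
    · linarith
    · obtain ⟨s, hs, hs'⟩ := hf
      rcases List.mem_cons.1 hs with rfl | hs
      · exact absurd hs' h
      · have := ih q h5 ⟨s, hs, hs'⟩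
        linarith

/-- Earlier sweeps start strictly to the right of `l f`, so none of them reads `f`, and each costs
two U-turns. -/
theorem serviceTime_ge (I : Instance) {U : ℝ} (hU : 0 ≤ U) (f : Fin I.nf) (pos : ℝ)
    (S : List (ℝ × ℝ)) (hS : I.IsTrajectory pos S)
    (hf : ∃ s ∈ S, s.1 ≤ I.l f ∧ I.r f ≤ s.2) :
    pos - sweepStart (I.l f) S + (I.r f - sweepStart (I.l f) S)
      + (2 * sweepIndex (I.l f) S + 1) * U ≤ I.serviceTime U f pos S := by
  induction S generalizing pos with
  | nil => simp at hf
  | cons s S ih =>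
    obtain ⟨p, q⟩ := s
    obtain ⟨-, h2, h3, -, h5⟩ := hS
    have hrest : ¬ (p ≤ I.l f ∧ I.r f ≤ q) → ∃ s ∈ S, s.1 ≤ I.l f ∧ I.r f ≤ s.2 := by
      intro h
      obtain ⟨s, hs, hs'⟩ := hf
      rcases List.mem_cons.1 hs with rfl | hs
      exacts [absurd hs' h, ⟨s, hs, hs'⟩]
    by_cases hp : p ≤ I.l f
    · rw [sweepStart_cons_of_le S hp, sweepIndex, if_pos hp, serviceTime]
      split_ifs with h
      · push_cast; linarith
      · have := I.serviceTime_ge_direct hU f q S h5 (hrest h)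
        push_cast; linarith
    · have hn : ¬ (p ≤ I.l f ∧ I.r f ≤ q) := fun h => hp h.1
      have := ih q h5 (hrest hn)
      rw [sweepStart_cons_of_lt S hp, sweepIndex, if_neg hp, serviceTime, if_neg hn]
      push_cast; linarith

theorem cost_simpleDP_le (I : Instance) {U : ℝ} (hU : 0 ≤ U) (S : List (ℝ × ℝ)) :
    I.cost U (I.simpleDP U) ≤ 3 * I.cost U S := by
  by_cases hS : I.IsSchedule S
  swap
  · rw [cost.eq_def I U S, if_neg hS, ENNReal.mul_top (by norm_num)]
    exact le_top
  rw [cost_simpleDP, cost.eq_def I U S, if_pos hS, sum_req,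
    show (3 : ℝ≥0∞) = ENNReal.ofReal 3 by simp, ← ENNReal.ofReal_mul (by norm_num)]
  refine ENNReal.ofReal_le_ofReal ?_
  have hT := I.simpleCell_first_le hU (fun f => sweepIndex (I.l f) S)
    (fun f => sweepStart (I.l f) S)
    (fun f c hfc => sweepIndex_anti S (I.l_strictMono.monotone hfc))
    (fun f c h => by simp only [sweepStart]; rw [h])
    (fun f => sweepStart_le (I.l_nonneg _) S) I.last
  have hlast : Iic I.last = univ := by ext f; simp [I.le_last f]
  rw [hlast] at hT
  refine (add_le_add_right hT _).trans ?_
  rw [directCost, ← sum_add_distrib, mul_sum]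
  refine sum_le_sum fun f _ => ?_
  rw [← mul_add, mul_left_comm]
  refine mul_le_mul_of_nonneg_left ?_ (Nat.cast_nonneg _)
  have h1 := I.serviceTime_ge hU f I.m S hS.1 (hS.2 f f.2)
  have h2 := sweepStart_le (I.l_nonneg f) S
  have h3 := I.r_le_m I.last
  have h4 : I.r f = I.l f + I.size f := rfl
  have h5 : (0 : ℝ) < I.size f := Nat.cast_pos.2 (I.size_pos f)
  have h6 : 0 ≤ (sweepIndex (I.l f) S : ℝ) * U := mul_nonneg (Nat.cast_nonneg _) hU
  have h7 : 0 ≤ (sweepIndex (I.l I.last) S : ℝ) * U := mul_nonneg (Nat.cast_nonneg _) hU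
  linarith

end Instance

theorem approxRatio_simpleDP_le {U : ℝ} (hU : 0 ≤ U) :
    approxRatio U (Instance.simpleDP U) ≤ 3 := by
  refine iSup_le fun I => ENNReal.div_le_of_le_mul ?_
  rw [Instance.opt, ENNReal.mul_iInf_of_ne (by norm_num) (by norm_num)]
  exact le_iInf fun S => I.cost_simpleDP_le hU S

namespace Instance
open Finset

/-! ### The lower bound -/

/-- From left to right: a file with a single request, a gap of length `n * A`, a small file with
`n ^ 2` requests, a gap of length `A`, another small file with `n ^ 2` requests, and a file of
length `A` with `n` requests. -/
def nestedInstance (n A : ℕ) (hn : 0 < n) (hA : 0 < A) : Instance where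
  nf := 6
  size := ![1, n * A, 1, A, 1, A]
  size_pos := by
    intro f
    have := Nat.mul_pos hn hA
    fin_cases f <;> simp [*]
  x := ![1, 0, n ^ 2, 0, n ^ 2, n]
  exists_request := ⟨0, by simp⟩

section

variable {n A : ℕ} (hn : 0 < n) (hA : 0 < A)

theorem nestedInstance_l (f : Fin 6) : (nestedInstance n A hn hA).l f =
    (![0, 1, n * A + 1, n * A + 2, n * A + A + 2, n * A + A + 3] : Fin 6 → ℝ) f := by
  refine (sum_filter _ _).trans ?_
  change ∑ g : Fin 6, (if g < f then (((![1, n * A, 1, A, 1, A] : Fin 6 → ℕ) g : ℕ) : ℝ) else 0) = _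
  fin_cases f <;> simp [Fin.sum_univ_succ] <;> ring

theorem nestedInstance_m : (nestedInstance n A hn hA).m = n * A + 2 * A + 3 := by
  change ∑ g : Fin 6, (((![1, n * A, 1, A, 1, A] : Fin 6 → ℕ) g : ℕ) : ℝ) = _
  simp [Fin.sum_univ_succ]; ring

theorem nestedInstance_r (f : Fin 6) : (nestedInstance n A hn hA).r f =
    (![1, n * A + 1, n * A + 2, n * A + A + 2, n * A + A + 3, n * A + 2 * A + 3] :
      Fin 6 → ℝ) f := by
  refine (congrArg (· + _) (nestedInstance_l hn hA f)).trans ?_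
  change _ + (((![1, n * A, 1, A, 1, A] : Fin 6 → ℕ) f : ℕ) : ℝ) = _
  fin_cases f <;> simp <;> ring

theorem sum_nestedInstance (g : Fin 6 → ℝ) :
    ∑ f : Fin 6, ((nestedInstance n A hn hA).x f : ℝ) * g f =
      g 0 + n ^ 2 * g 2 + n ^ 2 * g 4 + n * g 5 := by
  change ∑ f : Fin 6, (((![1, 0, n ^ 2, 0, n ^ 2, n] : Fin 6 → ℕ) f : ℕ) : ℝ) * g f = _
  simp [Fin.sum_univ_succ]; ring

theorem opt_nestedInstance_le (U : ℝ) : (nestedInstance n A hn hA).opt U ≤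
    ENNReal.ofReal (n ^ 2 * (3 * A + 7 + 4 * U) + n * (4 * A + 6 + 3 * U)
      + (6 * A + n * A + 10 + 5 * U)) := by
  set I := nestedInstance n A hn hA with hI
  have hA' : (0 : ℝ) < A := Nat.cast_pos.2 hA
  have hnA : (0 : ℝ) < n * A := mul_pos (Nat.cast_pos.2 hn) hA'
  have l0 : I.l (0 : Fin 6) = 0 := nestedInstance_l hn hA 0
  have r0 : I.r (0 : Fin 6) = 1 := nestedInstance_r hn hA 0
  have l2 : I.l (2 : Fin 6) = n * A + 1 := nestedInstance_l hn hA 2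
  have r2 : I.r (2 : Fin 6) = n * A + 2 := nestedInstance_r hn hA 2
  have l4 : I.l (4 : Fin 6) = n * A + A + 2 := nestedInstance_l hn hA 4
  have r4 : I.r (4 : Fin 6) = n * A + A + 3 := nestedInstance_r hn hA 4
  have l5 : I.l (5 : Fin 6) = n * A + A + 3 := nestedInstance_l hn hA 5
  have r5 : I.r (5 : Fin 6) = n * A + 2 * A + 3 := nestedInstance_r hn hA 5
  have hm : I.m = n * A + 2 * A + 3 := nestedInstance_m hn hA
  -- Nested detours: file `4` is read alone, then again within the sweep from file `2` to the end of
  -- the tape.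
  let S : List (ℝ × ℝ) := [((n * A + A + 2 : ℝ), (n * A + A + 3 : ℝ)),
    ((n * A + 1 : ℝ), (n * A + 2 * A + 3 : ℝ)), (0, 1)]
  have hS : I.IsSchedule S := by
    refine ⟨?_, fun f hf => ?_⟩
    · simp only [S, IsTrajectory, hm]
      refine ⟨?_, ?_, ?_, ?_, ?_, ?_, ?_, ?_, ?_, ?_, ?_, ?_, trivial⟩ <;> linarith
    · have key : ∀ f, (∃ s ∈ S, s.1 ≤ I.l f ∧ I.r f ≤ s.2) ↔
          (n * A + A + 2 ≤ I.l f ∧ I.r f ≤ n * A + A + 3) ∨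
          (n * A + 1 ≤ I.l f ∧ I.r f ≤ n * A + 2 * A + 3) ∨ (0 ≤ I.l f ∧ I.r f ≤ 1) := by
        simp [S]
      rw [key]
      change Fin 6 at f
      fin_cases f
      · exact Or.inr (Or.inr ⟨l0.ge, r0.le⟩)
      · exact absurd hf (lt_irrefl 0)
      · exact Or.inr (Or.inl ⟨l2.ge, r2.trans_le (by linarith)⟩)
      · exact absurd hf (lt_irrefl 0)
      · exact Or.inl ⟨l4.ge, r4.le⟩
      · exact Or.inr (Or.inl ⟨le_of_le_of_eq (by linarith) l5.symm, r5.le⟩)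
  refine (iInf_le _ S).trans ?_
  rw [cost, if_pos hS]
  refine ENNReal.ofReal_le_ofReal (le_of_eq ?_)
  refine (sum_nestedInstance hn hA fun f => I.serviceTime U f I.m S).trans ?_
  have t4 : I.serviceTime U (4 : Fin 6) I.m S = A + 2 + U := by
    simp only [S, serviceTime]
    rw [l4, r4, hm, if_pos ⟨le_rfl, le_rfl⟩]
    ring
  have t2 : I.serviceTime U (2 : Fin 6) I.m S = 2 * A + 5 + 3 * U := by
    simp only [S, serviceTime]
    rw [l2, r2, hm, if_neg (fun h => by linarith [h.1]),
      if_pos ⟨le_rfl, by linarith⟩]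
    ring
  have t5 : I.serviceTime U (5 : Fin 6) I.m S = 4 * A + 6 + 3 * U := by
    simp only [S, serviceTime]
    rw [l5, r5, hm, if_neg (fun h => by linarith [h.2]),
      if_pos ⟨by linarith, le_rfl⟩]
    ring
  have t0 : I.serviceTime U (0 : Fin 6) I.m S = 6 * A + n * A + 10 + 5 * U := by
    simp only [S, serviceTime]
    rw [l0, r0, hm, if_neg (fun h => by linarith [h.1]),
      if_neg (fun h => by linarith [h.1]), if_pos ⟨le_rfl, le_rfl⟩]
    ring
  rw [t0, t2, t4, t5]
  ring

/-- Files `2` and `4` suffice: `n ^ 2` requests each, at distances at least `2 * A` and `A` from the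
right end. -/
theorem directCost_nestedInstance_ge {U : ℝ} (hU : 0 ≤ U) :
    3 * (n ^ 2 * A : ℝ) ≤ (nestedInstance n A hn hA).directCost U := by
  set I := nestedInstance n A hn hA with hI
  have h := (I.sum_req fun f => I.m - I.l f + I.size f + U).symm.trans
    (sum_nestedInstance hn hA fun f => I.m - I.l f + I.size f + U)
  have hpos : ∀ f : Fin 6, I.m - I.l f ≤ I.m - I.l f + I.size f + U := fun f => by
    have : (0 : ℝ) ≤ I.size f := Nat.cast_nonneg _
    linarith
  have h0 := hpos 0
  have h2 := hpos 2
  have h4 := hpos 4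
  have h5 := hpos 5
  have l0 : I.l (0 : Fin 6) = 0 := nestedInstance_l hn hA 0
  have l2 : I.l (2 : Fin 6) = n * A + 1 := nestedInstance_l hn hA 2
  have l4 : I.l (4 : Fin 6) = n * A + A + 2 := nestedInstance_l hn hA 4
  have l5 : I.l (5 : Fin 6) = n * A + A + 3 := nestedInstance_l hn hA 5
  have hm : I.m = n * A + 2 * A + 3 := nestedInstance_m hn hA
  have hnA : (0 : ℝ) ≤ n * A := by positivity
  rw [directCost, h]
  have hn2 : (0 : ℝ) ≤ n ^ 2 := by positivity
  have hn0 : (0 : ℝ) ≤ n := by positivity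
  have hA0 : (0 : ℝ) ≤ A := by positivity
  have e2 := mul_le_mul_of_nonneg_left (a := (n : ℝ) ^ 2) (b := 2 * A)
    (c := I.m - I.l (2 : Fin 6) + I.size (2 : Fin 6) + U) (by linarith) hn2
  have e4 := mul_le_mul_of_nonneg_left (a := (n : ℝ) ^ 2) (b := A)
    (c := I.m - I.l (4 : Fin 6) + I.size (4 : Fin 6) + U) (by linarith) hn2
  have e5 := mul_nonneg hn0 (a := (n : ℝ))
    (b := I.m - I.l (5 : Fin 6) + I.size (5 : Fin 6) + U) (by linarith)
  linarith

theorem simpleCell_nestedInstance_ge {U : ℝ} (hU : 0 ≤ U) :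
    2 * (n ^ 2 * A : ℝ) ≤ ((nestedInstance n A hn hA).simpleCell U
      (nestedInstance n A hn hA).first (nestedInstance n A hn hA).last 0).1 := by
  set I := nestedInstance n A hn hA with hI
  have hA0 : (0 : ℝ) < A := Nat.cast_pos.2 hA
  have hn0 : (0 : ℝ) < n := Nat.cast_pos.2 hn
  have hn2 : 0 < n ^ 2 := by positivity
  let f0 : I.Req := ⟨(0 : Fin 6), Nat.one_pos⟩
  let f2 : I.Req := ⟨(2 : Fin 6), hn2⟩
  let f4 : I.Req := ⟨(4 : Fin 6), hn2⟩
  let f5 : I.Req := ⟨(5 : Fin 6), hn⟩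
  have hfirst : I.first = f0 :=
    le_antisymm (I.first_le _) (Fin.zero_le (n := 6) I.first.1)
  have hlast : I.last = f5 :=
    le_antisymm (Fin.le_last (n := 5) I.last.1) (I.le_last _)
  have h02 : f0 < f2 := show (0 : Fin 6) < 2 by decide
  have h24 : f2 < f4 := show (2 : Fin 6) < 4 by decide
  have h45 : f4 < f5 := show (4 : Fin 6) < 5 by decide
  have l0 : I.l f0 = 0 := nestedInstance_l hn hA 0
  have l2 : I.l f2 = n * A + 1 := nestedInstance_l hn hA 2
  have l4 : I.l f4 = n * A + A + 2 := nestedInstance_l hn hA 4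
  have l5 : I.l f5 = n * A + A + 3 := nestedInstance_l hn hA 5
  have r2 : I.r f2 = n * A + 2 := nestedInstance_r hn hA 2
  have r5 : I.r f5 = n * A + 2 * A + 3 := nestedInstance_r hn hA 5
  have x2 : I.x f2 = n ^ 2 := rfl
  have x4 : I.x f4 = n ^ 2 := rfl
  have x5 : I.x f5 = n := rfl
  have hlt : I.first < f5 := hfirst ▸ h02.trans (h24.trans h45)
  rw [hlast]
  rcases I.simpleCell_cases U hlt 0 with h | ⟨c, hc, h⟩ <;> rw [h]
  · have h1 := I.simpleCell_first_ge hU (I.left f5) (0 + I.x f5)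
    have h2 : I.r f2 ≤ I.r (I.left f5) :=
      I.r_strictMono.monotone ((I.lt_iff_le_left hlt f2).1 (h24.trans h45))
    have h3 := I.r_left_le hlt
    rw [skipCell, nleft_first]
    have e3 := mul_nonneg (sub_nonneg.2 h3) (Nat.cast_nonneg (α := ℝ) (I.x f5))
    rw [x5] at h1 e3 ⊢
    rw [hfirst, l0] at h1
    rw [hfirst]
    push_cast at h1 ⊢
    have : (n * A : ℝ) * n ≤ I.r (I.left f5) * n :=
      mul_le_mul_of_nonneg_right (by linarith) hn0.le
    nlinarith
  · obtain ⟨hac, hcb⟩ := mem_Ioc.1 hc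
    have hl0 := I.simpleCell_first_ge hU (I.left c) 0
    rw [Nat.cast_zero, mul_zero] at hl0
    rw [detourCell, nleft_first]
    simp only [Nat.cast_zero, zero_add, mul_zero, add_zero]
    have hlc : I.l c ≤ I.l f5 := I.l_strictMono.monotone hcb
    have hterm : ∀ f ∈ Ioc c f5, 0 ≤ 2 * (I.l f - I.l c) * (I.x f : ℝ) := fun f hf =>
      mul_nonneg (mul_nonneg zero_le_two
        (sub_nonneg.2 (I.l_strictMono.monotone (mem_Ioc.1 hf).1.le))) (Nat.cast_nonneg _)
    have hsum := sum_nonneg hterm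
    rcases le_or_gt c f2 with h2 | h2
    · have hc2 : I.l c ≤ I.l f2 := I.l_strictMono.monotone h2
      have e := single_le_sum hterm (mem_Ioc.2 ⟨h2.trans_lt h24, h45.le⟩)
      rw [x4] at e
      push_cast at e
      have e' : (A : ℝ) * n ^ 2 ≤ (I.l f4 - I.l c) * n ^ 2 :=
        mul_le_mul_of_nonneg_right (by linarith) (by positivity)
      have e'' : 0 ≤ 2 * (U + I.r f5 - I.l c) * (I.nleft c : ℝ) :=
        mul_nonneg (by linarith) (Nat.cast_nonneg _)
      linarith
    · have hx : n ^ 2 ≤ I.nleft c := by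
        rw [nleft_eq]
        exact single_le_sum (f := fun f : I.Req => I.x f) (fun _ _ => Nat.zero_le _)
          (mem_Iio.2 h2)
      have hx' : (n : ℝ) ^ 2 ≤ I.nleft c := by exact_mod_cast hx
      have e : (A : ℝ) * n ^ 2 ≤ (U + I.r f5 - I.l c) * I.nleft c :=
        mul_le_mul (by linarith) hx' (by positivity) (by linarith)
      linarith

end

end Instance

theorem le_approxRatio_simpleDP {U : ℝ} (hU : 0 ≤ U) :
    5 / 3 ≤ approxRatio U (Instance.simpleDP U) := by
  have key : ∀ n : ℕ, 0 < n →
      ENNReal.ofReal (5 / (3 + 50 / n)) ≤ approxRatio U (Instance.simpleDP U) := by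
    intro n hn
    -- With `A` at least `n` and `n * U`, all lower-order terms of the optimum, including those in
    -- `U`, are `O(n * A)`; the constant `50` is generous.
    obtain ⟨A, hA, hnA, hUA⟩ : ∃ A : ℕ, 0 < A ∧ (n : ℝ) ≤ A ∧ n * U ≤ A := by
      refine ⟨n * (⌈U⌉₊ + 1), by positivity, ?_, ?_⟩ <;> push_cast
      · exact le_mul_of_one_le_right (by positivity) (by simp)
      · exact mul_le_mul_of_nonneg_left ((Nat.le_ceil U).trans (by simp)) (by positivity)
    refine le_iSup_of_le (Instance.nestedInstance n A hn hA) ?_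
    have hn1 : (1 : ℝ) ≤ n := by exact_mod_cast hn
    have hA0 : (0 : ℝ) < A := by exact_mod_cast hA
    have hopt := Instance.opt_nestedInstance_le hn hA U
    have hcost := add_le_add (Instance.directCost_nestedInstance_ge hn hA hU)
      (Instance.simpleCell_nestedInstance_ge hn hA hU)
    rw [Instance.cost_simpleDP]
    have hbound : (n ^ 2 * (3 * A + 7 + 4 * U) + n * (4 * A + 6 + 3 * U)
        + (6 * A + n * A + 10 + 5 * U) : ℝ) ≤ (3 + 50 / n) * (n ^ 2 * A) := by
      have e : ((3 + 50 / n) * (n ^ 2 * A) : ℝ) = 3 * (n ^ 2 * A) + 50 * (n * A) := by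
        field_simp
      have e1 : (A : ℝ) ≤ n * A := le_mul_of_one_le_left hA0.le hn1
      have e2 : (n : ℝ) * n ≤ n * A := mul_le_mul_of_nonneg_left hnA (by positivity)
      have e3 : n * (n * U) ≤ n * A := mul_le_mul_of_nonneg_left hUA (by positivity)
      have e4 : (n : ℝ) ≤ n * n := le_mul_of_one_le_left (by positivity) hn1
      have e5 : U ≤ n * U := le_mul_of_one_le_left hU hn1
      rw [e]
      nlinarith
    refine le_trans ?_ (ENNReal.div_le_div (ENNReal.ofReal_le_ofReal hcost)
      (hopt.trans (ENNReal.ofReal_le_ofReal hbound)))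
    rw [← ENNReal.ofReal_div_of_pos (by positivity)]
    refine ENNReal.ofReal_le_ofReal (le_of_eq ?_)
    field_simp
    ring
  have hlim : Filter.Tendsto (fun n : ℕ => ENNReal.ofReal (5 / (3 + 50 / n))) Filter.atTop
      (nhds (ENNReal.ofReal (5 / (3 + 0)))) :=
    ENNReal.tendsto_ofReal (tendsto_const_nhds.div
      ((tendsto_const_div_atTop_nhds_zero_nat (50 : ℝ)).const_add 3) (by norm_num))
  have h53 : ENNReal.ofReal (5 / (3 + 0)) = 5 / 3 := by
    rw [add_zero, ENNReal.ofReal_div_of_pos (by norm_num)]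
    simp
  rw [← h53]
  exact le_of_tendsto hlim (Filter.eventually_atTop.2 ⟨1, fun n hn => key n hn⟩)

end LTSP

theorem mainTheorem3 (U : ℝ) (hU : 0 ≤ U) :
    LTSP.approxRatio U (LTSP.Instance.simpleDP U) ∈ Set.Icc (5 / 3 : ENNReal) 3 :=
  ⟨LTSP.le_approxRatio_simpleDP hU, LTSP.approxRatio_simpleDP_le hU⟩
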